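/- **Definitions.** A *graph* $G=(X,b)$ is a nonempty countable set $X$ with a symmetric function $b\colon X\times X\to[0,\infty)$ that vanishes on the diagonal and satisfies $\deg(x):=\sum_{y\in X}b(x,y)<\infty$ for all $x\in X$. Write $x\sim y$ if $b(x,y)>0$. The graph is *connected* if any two vertices are joined by a finite path $x=x_1\sim x_2\sim\dots\sim x_n=y$. It has *bounded geometry* if $\sup_{x}\deg(x)<\infty$. The *energy* of $f\colon X\to\mathbb R$ is $Q(f)=\frac12\sum_{x,y}b(x,y)(f(x)-f(y))^2\in[0,\infty]$. Let $\mathfrak D_0(G)$ be the closure of the finitely supported functions in $\{f: Q(f)<\infty\}$ with respect to $\|f\|_o=(Q(f)+|f(o)|^2)^{1/2}$, where $o\in X$ (the choice of $o$ is irrelevant if $G$ is connected); $G$ is *transient* if $1\notin\mathfrak D_0(G)$. A function $f\colon X\to\mathbb R$ is *harmonic* if $f(x)=\frac1{\deg(x)}\sum_{y}b(x,y)f(y)$ for all $x$, with absolutely convergent sums. A *finite measure* is a function $m\colon X\to(0,\infty)$ with $\sum_x m(x)<\infty$. A metric $\sigma$ on $X$ is *intrinsic* with respect to $m$ if $\frac12\sum_{y}b(x,y)\sigma(x,y)^2\le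 m(x)$ for all $x$. For $U\subseteq X$ put $$\mathrm{cap}_m(U)=\inf\Big\{Q(f)+\sum_x m(x)f(x)^2 \;:\; f\in\ell^2(X,m),\ Q(f)<\infty,\ f\ge1\text{ on }U\Big\}\qquad(\inf\emptyset=\infty).$$ If $\sigma$ induces the discrete topology, let $\overline X^\sigma$ be the completion of $(X,\sigma)$ and $\partial_\sigma X=\overline X^\sigma\setminus X$, and for $A\subseteq\overline X^\sigma$ put $\mathrm{cap}_m(A)=\inf\{\mathrm{cap}_m(O\cap X): O\supseteq A\text{ open in }\overline X^\sigma\}$. A metric $\sigma$ on $X$ is a *resolving metric* for $G$ if it induces the discrete topology and is intrinsic with respect to some finite measure $m$ such that $\mathrm{cap}_m(\{w\})=0$ for all $w\in\partial_\sigma X$. The graph $G$ is *strongly resolvable* if it has a resolving metric. A *circle packing* indexed by $X$ consists of maps $r\colon X\to(0,\infty)$ and $\varphi\colon X\to\mathbb R^2$ such that the closed discs $C_x=\{z\in\mathbb R^2:|z-\varphi(x)|\le r(x)\}$ have pairwise disjoint interiors. It is *bounded* if $\bigcup_xC_x$ is bounded. The edge weight $b$ is *subordinate* to it if $b(x,y)>0$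 implies $C_x\cap C_y\ne\emptyset$. **Theorem.** Let $(X,b)$ be a connected graph of bounded geometry whose edge weight is subordinate to a bounded circle packing $(C_x)_{x\in X}$ in the plane with centres $\varphi(x)$. Then $\sigma(x,y)=|\varphi(x)-\varphi(y)|$ is a resolving metric for $(X,b)$; in particular, $(X,b)$ is strongly resolvable. Moreover, if $(X,b)$ is transient, then there is a non-constant harmonic function $h\colon X\to\mathbb R$ with $Q(h)<\infty$. -/

import Mathlib

open scoped ENNReal

noncomputable section

/-- A graph `(X, b)` : a symmetric edge weight `b : X × X → [0, ∞)` that vanishes on the diagonal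
and has finite weighted vertex degrees. (Countability and non-emptiness of `X` are stated as
`[Countable X] [Nonempty X]`, connectedness as `WeightedGraph.Connected`.) -/
structure WeightedGraph (X : Type*) where
  b : X → X → ℝ
  b_nonneg : ∀ x y, 0 ≤ b x y
  b_symm : ∀ x y, b x y = b y x
  b_self : ∀ x, b x x = 0
  b_summable : ∀ x, Summable (b x)

namespace WeightedGraph

variable {X : Type*} (G : WeightedGraph X)

/-- The weighted vertex degree `deg x = ∑ y, b x y`. -/
def deg (x : X) : ℝ := ∑' y, G.b x y

/-- Bounded geometry: the weighted vertex degree is bounded. -/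
def BoundedGeometry : Prop := ∃ C : ℝ, ∀ x, G.deg x ≤ C

/-- The underlying combinatorial graph: `x ∼ y` iff `b x y > 0`. -/
def toSimpleGraph : SimpleGraph X where
  Adj x y := 0 < G.b x y
  symm := ⟨fun x y h => by rw [G.b_symm]; exact h⟩
  loopless := ⟨fun x h => by rw [G.b_self] at h; exact lt_irrefl _ h⟩

/-- Any two vertices are joined by a finite path. -/
def Connected : Prop := G.toSimpleGraph.Connected

/-- The Dirichlet energy `Q f = (1/2) ∑ x, ∑ y, b x y (f x - f y)² ∈ [0, ∞]`. -/
def energy (f : X → ℝ) : ℝ≥0∞ :=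
  2⁻¹ * ∑' x, ∑' y, ENNReal.ofReal (G.b x y * (f x - f y) ^ 2)

/-- Functions of finite energy. -/
def FiniteEnergy (f : X → ℝ) : Prop := G.energy f < ∞

/-- The norm `(Q f + |f o|²)^(1/2)` on functions of finite energy. -/
def energyNorm (o : X) (f : X → ℝ) : ℝ≥0∞ :=
  (G.energy f + ENNReal.ofReal (f o ^ 2)) ^ (1 / 2 : ℝ)

/-- The space `𝔇₀` : the closure, in the functions of finite energy with the norm `energyNorm o`,
of the finitely supported functions. -/
def energyZero (o : X) : Set (X → ℝ) :=
  {f | G.FiniteEnergy f ∧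
    ∀ ε : ℝ, 0 < ε → ∃ g : X → ℝ, g.support.Finite ∧ G.energyNorm o (f - g) < ENNReal.ofReal ε}

/-- Recurrence: the constant function `1` belongs to `𝔇₀`. On a connected graph `𝔇₀` does not
depend on the base point `o`. -/
def Recurrent : Prop := ∀ o : X, (fun _ => (1 : ℝ)) ∈ G.energyZero o

/-- Transient means not recurrent. -/
def Transient : Prop := ¬ G.Recurrent

/-- `f x ≥ (1 / deg x) ∑ y, b x y f y` for all `x`, with absolutely convergent sums. -/
def Superharmonic (f : X → ℝ) : Prop :=
  ∀ x, Summable (fun y => |G.b x y * f y|) ∧ (1 / G.deg x) * ∑' y, G.b x y * f y ≤ f x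

/-- Both `f` and `-f` are superharmonic. -/
def Harmonic (f : X → ℝ) : Prop := G.Superharmonic f ∧ G.Superharmonic (-f)

/-- The squared norm of `f` in `ℓ²(X, m)`, with values in `[0, ∞]`. -/
def l2NormSq (m : X → ℝ) (f : X → ℝ) : ℝ≥0∞ := ∑' x, ENNReal.ofReal (m x * f x ^ 2)

/-- The Sobolev space `H¹(G, m)` : functions in `ℓ²(X, m)` of finite energy. -/
def sobolev (m : X → ℝ) : Set (X → ℝ) := {f | l2NormSq m f < ∞ ∧ G.FiniteEnergy f}

/-- The capacity of a set of vertices: the infimum of `‖f‖²_m + Q f` over all `f ∈ H¹(G, m)` with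
`f ≥ 1` on `U` (and `∞` if there is no such `f`). -/
def cap (m : X → ℝ) (U : Set X) : ℝ≥0∞ :=
  ⨅ f ∈ {f : X → ℝ | f ∈ G.sobolev m ∧ ∀ x ∈ U, 1 ≤ f x}, l2NormSq m f + G.energy f

/-- A finite measure on `X` of full support, given by its strictly positive point masses. -/
def IsFiniteMeas (m : X → ℝ) : Prop := (∀ x, 0 < m x) ∧ Summable m

/-- `σ` is intrinsic with respect to `m` : `(1/2) ∑ y, b x y σ(x, y)² ≤ m x` for all `x`. -/
def Intrinsic (m : X → ℝ) (σ : X → X → ℝ) : Prop :=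
  ∀ x, 2⁻¹ * ∑' y, ENNReal.ofReal (G.b x y * σ x y ^ 2) ≤ ENNReal.ofReal (m x)

section Metric

variable [MetricSpace X]

/-- The metric boundary: the points of the completion that do not come from `X`. -/
def metricBoundary (X : Type*) [MetricSpace X] : Set (UniformSpace.Completion X) :=
  (Set.range ((↑) : X → UniformSpace.Completion X))ᶜ

/-- The capacity of a subset of the completion: the infimum of the capacities of `O ∩ X` over all
open `O` that contain it. -/
def capCompletion (m : X → ℝ) (A : Set (UniformSpace.Completion X)) : ℝ≥0∞ :=
  ⨅ O ∈ {O : Set (UniformSpace.Completion X) | IsOpen O ∧ A ⊆ O},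
    G.cap m (((↑) : X → UniformSpace.Completion X) ⁻¹' O)

/-- The metric of `X` is resolving for `G` : it induces the discrete topology and is intrinsic with
respect to a finite measure `m` for which every boundary point has capacity zero. -/
def MetricResolves : Prop :=
  DiscreteTopology X ∧ ∃ m : X → ℝ, IsFiniteMeas m ∧ G.Intrinsic m dist ∧
    ∀ w ∈ metricBoundary X, G.capCompletion m {w} = 0

end Metric

/-- `σ` is a resolving metric for `G`. -/
def IsResolvingMetric (σ : MetricSpace X) : Prop := @MetricResolves X G σ

/-- `G` is strongly resolvable: it has a resolving metric. -/
def StronglyResolvable : Prop := ∃ σ : MetricSpace X, G.IsResolvingMetric σ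

end WeightedGraph

/-- A circle packing in the Euclidean plane: closed discs of positive radii, indexed by `X`, with
pairwise disjoint interiors. -/
structure CirclePacking (X : Type*) where
  radius : X → ℝ
  center : X → EuclideanSpace ℝ (Fin 2)
  radius_pos : ∀ x, 0 < radius x
  disjoint_interior : ∀ x y, x ≠ y →
    interior (Metric.closedBall (center x) (radius x)) ∩
      interior (Metric.closedBall (center y) (radius y)) = ∅

namespace CirclePacking

variable {X : Type*} (P : CirclePacking X)

/-- The closed disc of the vertex `x`. -/
def disc (x : X) : Set (EuclideanSpace ℝ (Fin 2)) := Metric.closedBall (P.center x) (P.radius x)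

/-- The union of all discs is a bounded set. -/
def Bounded : Prop := Bornology.IsBounded (⋃ x, P.disc x)

/-- The edge weight of `G` is subordinate to the packing: discs of neighbours meet. -/
def Subordinate (G : WeightedGraph X) : Prop :=
  ∀ x y, 0 < G.b x y → (P.disc x ∩ P.disc y).Nonempty

theorem center_injective : Function.Injective P.center := by
  intro x y h
  by_contra hne
  have hx : P.center x ∈ interior (Metric.closedBall (P.center x) (P.radius x)) :=
    Metric.ball_subset_interior_closedBall (Metric.mem_ball_self (P.radius_pos x))
  have hy : P.center x ∈ interior (Metric.closedBall (P.center y) (P.radius y)) := by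
    rw [h]
    exact Metric.ball_subset_interior_closedBall (Metric.mem_ball_self (P.radius_pos y))
  have hxy := P.disjoint_interior x y hne
  exact (Set.eq_empty_iff_forall_notMem.mp hxy) _ ⟨hx, hy⟩

/-- The Euclidean metric of the centres, `σ(x, y) = |φ(x) - φ(y)|`. -/
@[reducible] def centerMetric : MetricSpace X :=
  MetricSpace.induced P.center P.center_injective inferInstance

end CirclePacking

end

/-! Everything rests on area. Disjoint discs in a bounded region have summable squared radii, and
the centres of neighbours are at most the sum of their radii apart. With bounded degree this yields
a finite measure for which the Euclidean metric is intrinsic, and finite energy for functions that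
are Lipschitz in the centres.

Points of the plane other than centres have capacity zero. The linear cut-offs at scale `ρ` about
such a point `z` have energy bounded independently of `ρ` (`energy_cutoff_le`), because an edge near
`z` is paid for by disc area within distance `5ρ`. These energies need not tend to zero. But the
cut-offs are bounded in the form norm and tend to `0` pointwise, hence weakly, so convex
combinations of them, still at least `1` near `z`, are arbitrarily small
(`Convex.mem_of_tendsto_apply`, `exists_formNorm_lt`). The completion embeds isometrically in the
plane with boundary points going to non-centres, so the metric is resolving.

For the harmonic function, suppose that every harmonic function of finite energy is constant.
Projection in Hilbert space then writes each function of finite energy as a constant plus an element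
of `𝔇₀` (`exists_vanishesAtBoundary_sub_const`). Applied to the two coordinates of the centres, this
gives a point `z` whose distance to the centres is dominated by some `d` in `𝔇₀`. As `𝔇₀` is an
order ideal (`VanishesAtBoundary.of_le_abs`), it contains `1` up to an error concentrated near `z`.
The error is a single vertex if `z` is a centre, and has arbitrarily small norm otherwise. So `1 ∈
𝔇₀`, and the graph is recurrent. -/

open scoped ENNReal

noncomputable section

open Filter Topology

/-! ### Weak convergence in `ℓ²` -/

section HilbertSequence

variable {ι : Type*}

/-- A bounded sequence in `ℓ²` that converges coordinatewise converges weakly. -/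
theorem tendsto_inner_of_tendsto_apply {v : ℕ → lp (fun _ : ι => ℝ) 2}
    {w : lp (fun _ : ι => ℝ) 2} {M : ℝ} (hM : ∀ n, ‖v n‖ ≤ M)
    (h : ∀ i, Tendsto (fun n => v n i) atTop (𝓝 (w i))) (p : lp (fun _ : ι => ℝ) 2) :
    Tendsto (fun n => inner ℝ p (v n)) atTop (𝓝 (inner ℝ p w)) := by
  classical
  have hM0 : 0 ≤ M := (norm_nonneg _).trans (hM 0)
  set B : ℝ := M + ‖w‖ + 1 with hB
  have hB0 : 0 < B := by positivity
  rw [Metric.tendsto_atTop]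
  intro ε hε
  have hs := lp.hasSum_single (p := 2) (by norm_num) p
  obtain ⟨s, hsε⟩ := ((Metric.tendsto_nhds.1 hs) (ε / (2 * B)) (by positivity)).exists
  -- Pairing with the finite truncation `q` involves finitely many coordinates; the tail `p - q` is
  -- small and is paired with bounded vectors.
  set q : lp (fun _ : ι => ℝ) 2 := ∑ i ∈ s, lp.single 2 i (p i) with hq
  have hqi : ∀ u : lp (fun _ : ι => ℝ) 2, inner ℝ q u = ∑ i ∈ s, p i * u i := by
    intro u
    rw [hq, sum_inner]
    refine Finset.sum_congr rfl fun i _ => ?_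
    rw [lp.inner_single_left]
    simp [mul_comm]
  have hqt : Tendsto (fun n => inner ℝ q (v n)) atTop (𝓝 (inner ℝ q w)) := by
    simp only [hqi]
    exact tendsto_finsetSum _ fun i _ => (h i).const_mul _
  obtain ⟨N, hN⟩ := (Metric.tendsto_atTop.1 hqt) (ε / 2) (by positivity)
  refine ⟨N, fun n hn => ?_⟩
  have h1 := hN n hn
  rw [Real.dist_eq, ← inner_sub_right] at h1 ⊢
  have h2 : inner ℝ p (v n - w) = inner ℝ (p - q) (v n - w) + inner ℝ q (v n - w) := by
    rw [← inner_add_left, sub_add_cancel]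
  have h3 : |inner ℝ (p - q) (v n - w)| ≤ ‖p - q‖ * ‖v n - w‖ := abs_real_inner_le_norm _ _
  have h4 : ‖p - q‖ ≤ ε / (2 * B) := by
    rw [← dist_eq_norm, dist_comm]; exact hsε.le
  have h5 : ‖v n - w‖ ≤ B := by
    have := norm_sub_le (v n) w
    have := hM n
    linarith
  have h6 : ‖p - q‖ * ‖v n - w‖ ≤ ε / (2 * B) * B := by gcongr
  have h7 : ε / (2 * B) * B = ε / 2 := by field_simp
  rw [h2]
  have := abs_add_le (inner ℝ (p - q) (v n - w)) (inner ℝ q (v n - w))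
  linarith

/-- A closed convex set in `ℓ²` contains the coordinatewise limits of its bounded sequences. -/
theorem Convex.mem_of_tendsto_apply {K : Set (lp (fun _ : ι => ℝ) 2)} (hK : Convex ℝ K)
    (hKc : IsClosed K) {v : ℕ → lp (fun _ : ι => ℝ) 2} (hv : ∀ n, v n ∈ K)
    {w : lp (fun _ : ι => ℝ) 2} {M : ℝ} (hM : ∀ n, ‖v n‖ ≤ M)
    (h : ∀ i, Tendsto (fun n => v n i) atTop (𝓝 (w i))) : w ∈ K := by
  -- With `p` the point of `K` nearest to `w`, the inequality `⟪w - p, v n - p⟫ ≤ 0` passes to the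
  -- weak limit and gives `‖w - p‖² ≤ 0`.
  obtain ⟨p, hp, hpm⟩ := exists_norm_eq_iInf_of_complete_convex ⟨v 0, hv 0⟩ hKc.isComplete hK w
  rw [norm_eq_iInf_iff_real_inner_le_zero hK hp] at hpm
  have ht := (tendsto_inner_of_tendsto_apply hM h (w - p)).sub_const (inner ℝ (w - p) p)
  have hle : inner ℝ (w - p) w - inner ℝ (w - p) p ≤ 0 :=
    le_of_tendsto' ht fun n => by rw [← inner_sub_right]; exact hpm _ (hv n)
  rw [← inner_sub_right, real_inner_self_eq_norm_sq] at hle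
  have : w - p = 0 := by
    rw [← norm_eq_zero]
    nlinarith [norm_nonneg (w - p)]
  rwa [sub_eq_zero.1 this]

theorem lp.ofReal_norm_sq_eq_tsum (v : lp (fun _ : ι => ℝ) 2) :
    ENNReal.ofReal (‖v‖ ^ 2) = ∑' i, ENNReal.ofReal (v i ^ 2) := by
  have h := lp.hasSum_norm (p := 2) (by norm_num) v
  simp only [ENNReal.toReal_ofNat, Real.rpow_ofNat, Real.norm_eq_abs, sq_abs] at h
  rw [← h.tsum_eq, ENNReal.ofReal_tsum_of_nonneg (fun _ => sq_nonneg _) h.summable]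

theorem lp.exists_coe_eq_of_tsum_lt_top {f : ι → ℝ} (hf : ∑' i, ENNReal.ofReal (f i ^ 2) < ∞) :
    ∃ v : lp (fun _ : ι => ℝ) 2, ⇑v = f := by
  refine ⟨⟨f, memℓp_gen ?_⟩, rfl⟩
  have h := ENNReal.summable_toReal hf.ne
  simpa [ENNReal.toReal_ofReal, sq_nonneg] using h

end HilbertSequence

/-! ### The form norm as an `ℓ²` norm -/

namespace WeightedGraph

variable {X : Type*} (G : WeightedGraph X)

/-- The form norm `Q f + ∑ x, μ x (f x)²`. -/
def formNorm (μ f : X → ℝ) : ℝ≥0∞ := G.energy f + l2NormSq μ f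

/-- The coordinates of `f` in an `ℓ²` space in which `formNorm` becomes the squared norm. -/
def formVec (μ f : X → ℝ) : (X × X) ⊕ X → ℝ :=
  Sum.elim (fun p => √(G.b p.1 p.2 / 2) * (f p.1 - f p.2)) (fun x => √(μ x) * f x)

variable {G} {μ : X → ℝ}

theorem formVec_add (f g : X → ℝ) : G.formVec μ (f + g) = G.formVec μ f + G.formVec μ g := by
  ext (i | i) <;> simp [formVec] <;> ring

theorem formVec_sub (f g : X → ℝ) : G.formVec μ (f - g) = G.formVec μ f - G.formVec μ g := by
  ext (i | i) <;> simp [formVec] <;> ring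

theorem formVec_smul (c : ℝ) (f : X → ℝ) : G.formVec μ (c • f) = c • G.formVec μ f := by
  ext (i | i) <;> simp [formVec] <;> ring

theorem formVec_zero : G.formVec μ 0 = 0 := by
  ext (i | i) <;> simp [formVec]

/-- Edges enter as ordered pairs, so the weight `b / 2` in `formVec` absorbs the factor one half of
the energy. -/
theorem tsum_formVec_sq (hμ : ∀ x, 0 ≤ μ x) (f : X → ℝ) :
    ∑' i, ENNReal.ofReal (G.formVec μ f i ^ 2) = G.formNorm μ f := by
  have h1 : ∑' p : X × X, ENNReal.ofReal (G.formVec μ f (Sum.inl p) ^ 2) = G.energy f := by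
    rw [ENNReal.tsum_prod' (f := fun p : X × X => ENNReal.ofReal (G.formVec μ f (Sum.inl p) ^ 2)),
      energy, ← ENNReal.tsum_mul_left]
    refine tsum_congr fun x => ?_
    rw [← ENNReal.tsum_mul_left]
    refine tsum_congr fun y => ?_
    have h0 : (2⁻¹ : ℝ≥0∞) = ENNReal.ofReal (2⁻¹) := by
      rw [ENNReal.ofReal_inv_of_pos (by norm_num)]; simp
    rw [h0, ← ENNReal.ofReal_mul (by norm_num)]
    congr 1
    simp only [formVec, Sum.elim_inl, mul_pow]
    rw [Real.sq_sqrt (by have := G.b_nonneg x y; positivity)]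
    ring
  have h2 : ∑' x, ENNReal.ofReal (G.formVec μ f (Sum.inr x) ^ 2) = l2NormSq μ f := by
    refine tsum_congr fun x => ?_
    simp only [formVec, Sum.elim_inr, mul_pow]
    rw [Real.sq_sqrt (hμ x)]
  rw [formNorm, ← h1, ← h2]
  exact (HasSum.sum ENNReal.summable.hasSum ENNReal.summable.hasSum).tsum_eq

theorem ofReal_norm_sq_eq_formNorm (hμ : ∀ x, 0 ≤ μ x) {f : X → ℝ}
    {v : lp (fun _ : (X × X) ⊕ X => ℝ) 2} (hv : ⇑v = G.formVec μ f) :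
    ENNReal.ofReal (‖v‖ ^ 2) = G.formNorm μ f := by
  rw [lp.ofReal_norm_sq_eq_tsum, hv, tsum_formVec_sq hμ]

theorem exists_coe_eq_formVec (hμ : ∀ x, 0 ≤ μ x) {f : X → ℝ} (hf : G.formNorm μ f < ∞) :
    ∃ v : lp (fun _ : (X × X) ⊕ X => ℝ) 2, ⇑v = G.formVec μ f :=
  lp.exists_coe_eq_of_tsum_lt_top (by rwa [tsum_formVec_sq hμ])

theorem tendsto_formVec {f : ℕ → X → ℝ} {g : X → ℝ}
    (h : ∀ x, Tendsto (fun n => f n x) atTop (𝓝 (g x))) (i : (X × X) ⊕ X) :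
    Tendsto (fun n => G.formVec μ (f n) i) atTop (𝓝 (G.formVec μ g i)) := by
  rcases i with i | i
  · exact ((h _).sub (h _)).const_mul _
  · exact (h _).const_mul _

/-- Closed convex sets of functions, in the form norm, contain the pointwise limits of their
sequences with bounded form norm. -/
theorem mem_of_tendsto_pointwise (hμ : ∀ x, 0 ≤ μ x)
    {K : Set (lp (fun _ : (X × X) ⊕ X => ℝ) 2)} (hK : Convex ℝ K) (hKc : IsClosed K)
    {f : ℕ → X → ℝ} {C : ℝ≥0∞} (hC : C < ∞) (hf : ∀ n, G.formNorm μ (f n) ≤ C)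
    (hfK : ∀ n, ∀ v : lp (fun _ : (X × X) ⊕ X => ℝ) 2, ⇑v = G.formVec μ (f n) → v ∈ K)
    {g : X → ℝ} {w : lp (fun _ : (X × X) ⊕ X => ℝ) 2} (hw : ⇑w = G.formVec μ g)
    (h : ∀ x, Tendsto (fun n => f n x) atTop (𝓝 (g x))) : w ∈ K := by
  choose v hv using fun n => exists_coe_eq_formVec hμ ((hf n).trans_lt hC)
  refine hK.mem_of_tendsto_apply hKc (fun n => hfK n _ (hv n)) (M := √C.toReal) (fun n => ?_)
    (fun i => ?_)
  · apply Real.le_sqrt_of_sq_le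
    rw [← ENNReal.ofReal_le_iff_le_toReal hC.ne, ofReal_norm_sq_eq_formNorm hμ (hv n)]
    exact hf n
  · simp only [hv, hw]
    exact tendsto_formVec h i

/-! ### Comparison of energies -/

theorem energy_mono {f g : X → ℝ} (h : ∀ x y, (f x - f y) ^ 2 ≤ (g x - g y) ^ 2) :
    G.energy f ≤ G.energy g := by
  unfold energy
  refine mul_le_mul_right (ENNReal.tsum_le_tsum fun x => ENNReal.tsum_le_tsum fun y =>
    ENNReal.ofReal_le_ofReal ?_) _
  exact mul_le_mul_of_nonneg_left (h x y) (G.b_nonneg x y)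

theorem l2NormSq_mono (hμ : ∀ x, 0 ≤ μ x) {f g : X → ℝ} (h : ∀ x, f x ^ 2 ≤ g x ^ 2) :
    l2NormSq μ f ≤ l2NormSq μ g := by
  unfold l2NormSq
  exact ENNReal.tsum_le_tsum fun x =>
    ENNReal.ofReal_le_ofReal (mul_le_mul_of_nonneg_left (h x) (hμ x))

theorem formNorm_mono (hμ : ∀ x, 0 ≤ μ x) {f g : X → ℝ}
    (h : ∀ x y, (f x - f y) ^ 2 ≤ (g x - g y) ^ 2) (h' : ∀ x, f x ^ 2 ≤ g x ^ 2) :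
    G.formNorm μ f ≤ G.formNorm μ g :=
  add_le_add (energy_mono h) (l2NormSq_mono hμ h')

/-- Meant for lattice operations: an increment of a minimum is bounded by the corresponding
increment of one of the two functions. -/
theorem energy_le_add {f g k : X → ℝ}
    (h : ∀ x y, (k x - k y) ^ 2 ≤ (f x - f y) ^ 2 + (g x - g y) ^ 2) :
    G.energy k ≤ G.energy f + G.energy g := by
  unfold energy
  rw [← mul_add, ← ENNReal.tsum_add]
  gcongr with x
  rw [← ENNReal.tsum_add]
  gcongr with y
  rw [← ENNReal.ofReal_add (mul_nonneg (G.b_nonneg _ _) (sq_nonneg _))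
    (mul_nonneg (G.b_nonneg _ _) (sq_nonneg _)), ← mul_add]
  gcongr
  · exact G.b_nonneg x y
  · exact h x y

theorem l2NormSq_le_add (hμ : ∀ x, 0 ≤ μ x) {f g k : X → ℝ}
    (h : ∀ x, k x ^ 2 ≤ f x ^ 2 + g x ^ 2) : l2NormSq μ k ≤ l2NormSq μ f + l2NormSq μ g := by
  unfold l2NormSq
  rw [← ENNReal.tsum_add]
  gcongr with x
  rw [← ENNReal.ofReal_add (mul_nonneg (hμ _) (sq_nonneg _))
    (mul_nonneg (hμ _) (sq_nonneg _)), ← mul_add]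
  gcongr
  · exact hμ x
  · exact h x

theorem formNorm_le_add (hμ : ∀ x, 0 ≤ μ x) {f g k : X → ℝ}
    (h : ∀ x y, (k x - k y) ^ 2 ≤ (f x - f y) ^ 2 + (g x - g y) ^ 2)
    (h' : ∀ x, k x ^ 2 ≤ f x ^ 2 + g x ^ 2) :
    G.formNorm μ k ≤ G.formNorm μ f + G.formNorm μ g :=
  (add_le_add (energy_le_add h) (l2NormSq_le_add hμ h')).trans (add_add_add_comm _ _ _ _).le

theorem energy_const (c : ℝ) : G.energy (fun _ => c) = 0 := by
  simp [energy]

/-- Summation of a nonnegative function over the two ends of all edges. -/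
theorem tsum_tsum_ofReal_b_mul_add_le {C : ℝ} (hC : ∀ x, G.deg x ≤ C) {u : X → ℝ}
    (hu : ∀ x, 0 ≤ u x) :
    ∑' x, ∑' y, ENNReal.ofReal (G.b x y * (u x + u y)) ≤
      2 * (ENNReal.ofReal C * ∑' x, ENNReal.ofReal (u x)) := by
  have key : ∑' x, ∑' y, ENNReal.ofReal (G.b x y * u x) ≤
      ENNReal.ofReal C * ∑' x, ENNReal.ofReal (u x) := by
    rw [← ENNReal.tsum_mul_left]
    gcongr with x
    simp_rw [ENNReal.ofReal_mul (G.b_nonneg x _)]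
    rw [ENNReal.tsum_mul_right, ← ENNReal.ofReal_tsum_of_nonneg (G.b_nonneg x) (G.b_summable x)]
    gcongr
    exact hC x
  have key' : ∑' x, ∑' y, ENNReal.ofReal (G.b x y * u y) ≤
      ENNReal.ofReal C * ∑' x, ENNReal.ofReal (u x) := by
    rw [ENNReal.tsum_comm]
    simp_rw [fun x y => G.b_symm x y]
    exact key
  have hsplit : ∀ x y, ENNReal.ofReal (G.b x y * (u x + u y)) =
      ENNReal.ofReal (G.b x y * u x) + ENNReal.ofReal (G.b x y * u y) := fun x y => by
    rw [mul_add, ENNReal.ofReal_add (mul_nonneg (G.b_nonneg _ _) (hu _))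
      (mul_nonneg (G.b_nonneg _ _) (hu _))]
  simp_rw [hsplit, ENNReal.tsum_add]
  rw [two_mul]
  exact add_le_add key key'

end WeightedGraph

/-! ### Area estimates and cut-off functions -/

open MeasureTheory in
/-- Disjoint balls in a ball of the plane: the squares of the radii sum up to at most the square
of the big radius. -/
theorem tsum_ofReal_sq_radius_le {ι : Type*} {c : ι → EuclideanSpace ℝ (Fin 2)} {t : ι → ℝ}
    (ht : ∀ i, 0 ≤ t i) (hd : Pairwise fun i j => Disjoint (Metric.ball (c i) (t i))
      (Metric.ball (c j) (t j))) {z : EuclideanSpace ℝ (Fin 2)} {R : ℝ} (hR : 0 ≤ R)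
    (hsub : ∀ i, Metric.ball (c i) (t i) ⊆ Metric.ball z R) :
    ∑' i, ENNReal.ofReal (t i ^ 2) ≤ ENNReal.ofReal (R ^ 2) := by
  set V := volume (Metric.ball (0 : EuclideanSpace ℝ (Fin 2)) 1) with hV
  have hV0 : V ≠ 0 := (Metric.measure_ball_pos _ _ one_pos).ne'
  have hVt : V ≠ ∞ := measure_ball_lt_top.ne
  have hvol : ∀ (a : EuclideanSpace ℝ (Fin 2)) (r : ℝ), 0 ≤ r →
      volume (Metric.ball a r) = ENNReal.ofReal (r ^ 2) * V := fun a r hr => by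
    rw [Measure.addHaar_ball _ _ hr, finrank_euclideanSpace_fin]
  have h := tsum_meas_le_meas_iUnion_of_disjoint volume
    (fun i => (Metric.isOpen_ball (x := c i) (ε := t i)).measurableSet) hd
  have h2 := h.trans (measure_mono (Set.iUnion_subset hsub))
  simp_rw [fun i => hvol (c i) (t i) (ht i)] at h2
  rw [hvol z R hR, ENNReal.tsum_mul_right] at h2
  exact (ENNReal.mul_le_mul_iff_left hV0 hVt).1 h2

namespace CirclePacking

variable {X : Type*} (P : CirclePacking X)

theorem disjoint_ball {x y : X} (h : x ≠ y) : Disjoint (Metric.ball (P.center x) (P.radius x))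
    (Metric.ball (P.center y) (P.radius y)) := by
  rw [Set.disjoint_iff_inter_eq_empty]
  exact Set.subset_eq_empty (Set.inter_subset_inter Metric.ball_subset_interior_closedBall
    Metric.ball_subset_interior_closedBall) (P.disjoint_interior x y h)

theorem radius_le_dist {x y : X} (h : y ≠ x) : P.radius x ≤ dist (P.center y) (P.center x) := by
  by_contra! hlt
  exact Set.disjoint_left.1 (P.disjoint_ball h) (Metric.mem_ball_self (P.radius_pos y))
    (Metric.mem_ball.2 hlt)

variable {P}

theorem tsum_sq_radius_lt_top (hP : P.Bounded) :
    ∑' x, ENNReal.ofReal (P.radius x ^ 2) < ∞ := by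
  obtain ⟨R, hR⟩ := hP.subset_ball 0
  refine (tsum_ofReal_sq_radius_le (c := P.center) (fun x => (P.radius_pos x).le)
    (fun x y h => P.disjoint_ball h) (z := 0) (R := max R 0) (le_max_right _ _)
    fun x => ?_).trans_lt ENNReal.ofReal_lt_top
  exact Metric.ball_subset_closedBall.trans ((Set.subset_iUnion P.disc x).trans
    (hR.trans (Metric.ball_subset_ball (le_max_left _ _))))

theorem dist_center_le {G : WeightedGraph X} (hsub : P.Subordinate G) {x y : X}
    (h : 0 < G.b x y) : dist (P.center x) (P.center y) ≤ P.radius x + P.radius y := by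
  obtain ⟨p, hpx, hpy⟩ := hsub x y h
  have h1 : dist p (P.center x) ≤ P.radius x := hpx
  have h2 : dist p (P.center y) ≤ P.radius y := hpy
  have := dist_triangle_left (P.center x) (P.center y) p
  linarith

/-- The sum over the discs that meet a closed disc of radius `3ρ`, of the squares of the radii
truncated at `ρ`, is at most `25ρ²`. -/
theorem tsum_sq_truncated_radius_le {z : EuclideanSpace ℝ (Fin 2)} {ρ : ℝ} (hρ : 0 < ρ)
    {t : X → ℝ} (ht0 : ∀ x, 0 ≤ t x) (htr : ∀ x, t x ≤ P.radius x) (htρ : ∀ x, t x ≤ ρ)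
    (ht : ∀ x, t x ≠ 0 → (P.disc x ∩ Metric.closedBall z (3 * ρ)).Nonempty) :
    ∑' x, ENNReal.ofReal (t x ^ 2) ≤ ENNReal.ofReal ((5 * ρ) ^ 2) := by
  have hc : ∀ x, ∃ c, Metric.ball c (t x) ⊆ Metric.ball (P.center x) (P.radius x) ∧
      Metric.ball c (t x) ⊆ Metric.ball z (5 * ρ) := by
    intro x
    by_cases hx : t x = 0
    · exact ⟨0, by simp [hx]⟩
    obtain ⟨q, hq, hqz⟩ := ht x hx
    have hr := P.radius_pos x
    have hq' : ‖P.center x - q‖ ≤ P.radius x := by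
      rw [← dist_eq_norm, dist_comm]; exact hq
    have hqz' : dist q z ≤ 3 * ρ := hqz
    -- Shrink the disc by the homothety with centre `q` and ratio `s`. It stays inside the old disc,
    -- its new centre is within `t x` of `q`, and `3ρ + t x + t x ≤ 5ρ`.
    set s := t x / P.radius x with hs
    have hs0 : 0 ≤ s := div_nonneg (ht0 x) hr.le
    have hs1 : s ≤ 1 := (div_le_one hr).2 (htr x)
    have hsr : s * P.radius x = t x := by rw [hs]; field_simp
    refine ⟨q + s • (P.center x - q), Metric.ball_subset_ball' ?_, Metric.ball_subset_ball' ?_⟩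
    · have : q + s • (P.center x - q) - P.center x = -((1 - s) • (P.center x - q)) := by module
      rw [dist_eq_norm, this, norm_neg, norm_smul, Real.norm_of_nonneg (by linarith)]
      nlinarith
    · have h1 : dist (q + s • (P.center x - q)) q ≤ t x := by
        rw [dist_eq_norm, add_sub_cancel_left, norm_smul, Real.norm_of_nonneg hs0, ← hsr]
        gcongr
      have := dist_triangle (q + s • (P.center x - q)) q z
      have := htρ x
      linarith
  choose c hc1 hc2 using hc
  exact tsum_ofReal_sq_radius_le ht0
    (fun x y h => (P.disjoint_ball h).mono (hc1 x) (hc1 y)) (by positivity) hc2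

/-- The cut-off function that is `1` on the disc of radius `ρ` about `z` and vanishes outside the
disc of radius `2ρ`. -/
def cutoff (P : CirclePacking X) (z : EuclideanSpace ℝ (Fin 2)) (ρ : ℝ) (x : X) : ℝ :=
  max 0 (min 1 (2 - dist (P.center x) z / ρ))

theorem cutoff_nonneg (z : EuclideanSpace ℝ (Fin 2)) (ρ : ℝ) (x : X) : 0 ≤ P.cutoff z ρ x :=
  le_max_left _ _

theorem cutoff_le_one (z : EuclideanSpace ℝ (Fin 2)) (ρ : ℝ) (x : X) : P.cutoff z ρ x ≤ 1 :=
  max_le zero_le_one (min_le_left _ _)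

theorem cutoff_eq_one {z : EuclideanSpace ℝ (Fin 2)} {ρ : ℝ} (hρ : 0 < ρ) {x : X}
    (h : dist (P.center x) z < ρ) : P.cutoff z ρ x = 1 := by
  have : dist (P.center x) z / ρ ≤ 1 := (div_le_one hρ).2 h.le
  rw [cutoff, min_eq_left (by linarith), max_eq_right zero_le_one]

theorem cutoff_eq_zero {z : EuclideanSpace ℝ (Fin 2)} {ρ : ℝ} (hρ : 0 < ρ) {x : X}
    (h : 2 * ρ ≤ dist (P.center x) z) : P.cutoff z ρ x = 0 := by
  have : 2 ≤ dist (P.center x) z / ρ := (le_div_iff₀ hρ).2 h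
  exact max_eq_left ((min_le_right _ _).trans (by linarith))

theorem abs_cutoff_sub_le_one (z : EuclideanSpace ℝ (Fin 2)) (ρ : ℝ) (x y : X) :
    |P.cutoff z ρ x - P.cutoff z ρ y| ≤ 1 := by
  rw [abs_le]
  constructor <;> linarith [P.cutoff_nonneg z ρ x, P.cutoff_nonneg z ρ y, P.cutoff_le_one z ρ x,
    P.cutoff_le_one z ρ y]

theorem abs_cutoff_sub_le {z : EuclideanSpace ℝ (Fin 2)} {ρ : ℝ} (hρ : 0 < ρ) (x y : X) :
    |P.cutoff z ρ x - P.cutoff z ρ y| ≤ dist (P.center x) (P.center y) / ρ := by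
  refine (abs_max_sub_max_le_max _ _ _ _).trans ?_
  rw [sub_self, abs_zero]
  refine max_le (by positivity) ((abs_min_sub_min_le_max _ _ _ _).trans ?_)
  rw [sub_self, abs_zero]
  refine max_le (by positivity) ?_
  have : 2 - dist (P.center x) z / ρ - (2 - dist (P.center y) z / ρ) =
      (dist (P.center y) z - dist (P.center x) z) / ρ := by ring
  rw [this, abs_div, abs_of_pos hρ]
  gcongr
  rw [dist_comm (P.center x) (P.center y)]
  exact abs_dist_sub_le _ _ _

/-- The cut-off functions have uniformly bounded energy. -/
theorem energy_cutoff_le {G : WeightedGraph X} {C : ℝ} (hC : ∀ x, G.deg x ≤ C)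
    (hsub : P.Subordinate G) (z : EuclideanSpace ℝ (Fin 2)) {ρ : ℝ} (hρ : 0 < ρ) :
    G.energy (P.cutoff z ρ) ≤ ENNReal.ofReal C * 50 := by
  classical
  -- Truncation at `ρ`: a large disc may reach far beyond the neighbourhood of `z`, so only a
  -- subdisc of radius at most `ρ` is charged.
  set t : X → ℝ := fun x =>
    if (P.disc x ∩ Metric.closedBall z (3 * ρ)).Nonempty then min (P.radius x) ρ else 0 with ht
  have hm0 : ∀ x, 0 < min (P.radius x) ρ := fun x => lt_min (P.radius_pos x) hρ
  have ht0 : ∀ x, 0 ≤ t x := fun x => by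
    simp only [ht]; split_ifs; exacts [(hm0 x).le, le_rfl]
  have htr : ∀ x, t x ≤ P.radius x := fun x => by
    simp only [ht]; split_ifs; exacts [min_le_left _ _, (P.radius_pos x).le]
  have htρ : ∀ x, t x ≤ ρ := fun x => by
    simp only [ht]; split_ifs; exacts [min_le_right _ _, hρ.le]
  have htn : ∀ x, t x ≠ 0 → (P.disc x ∩ Metric.closedBall z (3 * ρ)).Nonempty := fun x h => by
    by_contra hx; exact h (if_neg hx)
  have harea := tsum_sq_truncated_radius_le hρ ht0 htr htρ htn
  set u : X → ℝ := fun x => 2 * (t x / ρ) ^ 2 with hu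
  have hu0 : ∀ x, 0 ≤ u x := fun x => by positivity
  -- an edge one of whose ends is close to `z`
  have key : ∀ x y, 0 < G.b x y → dist (P.center x) z < 2 * ρ →
      (P.cutoff z ρ x - P.cutoff z ρ y) ^ 2 ≤ u x + u y := by
    intro x y hb hx
    have htx : t x = min (P.radius x) ρ := if_pos ⟨P.center x,
      Metric.mem_closedBall_self (P.radius_pos x).le, Metric.mem_closedBall.2 (by linarith)⟩
    have h1 := P.abs_cutoff_sub_le_one z ρ x y
    have big : ∀ w, t w = ρ → (P.cutoff z ρ x - P.cutoff z ρ y) ^ 2 ≤ u w := by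
      intro w hw
      have : u w = 2 := by simp [hu, hw, div_self hρ.ne']
      rw [this]
      have := sq_le_one_iff_abs_le_one _ |>.2 h1
      linarith
    rcases le_total ρ (P.radius x) with hr | hr
    · exact (big x (by rw [htx, min_eq_right hr])).trans (le_add_of_nonneg_right (hu0 y))
    -- The contact point is within `radius x + 2ρ ≤ 3ρ` of `z`, so the disc of `y` is counted as
    -- well. This is why `t` uses the radius `3ρ`.
    obtain ⟨p, hpx, hpy⟩ := hsub x y hb
    have hpx' : dist p (P.center x) ≤ P.radius x := hpx
    have hty : t y = min (P.radius y) ρ := if_pos ⟨p, hpy, Metric.mem_closedBall.2 (by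
      have := dist_triangle p (P.center x) z
      linarith)⟩
    rcases le_total ρ (P.radius y) with hr' | hr'
    · exact (big y (by rw [hty, min_eq_right hr'])).trans (le_add_of_nonneg_left (hu0 x))
    rw [min_eq_left hr] at htx
    rw [min_eq_left hr'] at hty
    have h2 : |P.cutoff z ρ x - P.cutoff z ρ y| ≤ t x / ρ + t y / ρ := by
      refine (abs_cutoff_sub_le hρ x y).trans ?_
      rw [← add_div, htx, hty]
      gcongr
      exact dist_center_le hsub hb
    calc (P.cutoff z ρ x - P.cutoff z ρ y) ^ 2 = |P.cutoff z ρ x - P.cutoff z ρ y| ^ 2 :=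
          (sq_abs _).symm
      _ ≤ (t x / ρ + t y / ρ) ^ 2 := by gcongr
      _ ≤ 2 * (t x / ρ) ^ 2 + 2 * (t y / ρ) ^ 2 := by
        nlinarith [sq_nonneg (t x / ρ - t y / ρ)]
  have key2 : ∀ x y, G.b x y * (P.cutoff z ρ x - P.cutoff z ρ y) ^ 2 ≤ G.b x y * (u x + u y) := by
    intro x y
    rcases (G.b_nonneg x y).eq_or_lt with hb | hb
    · simp [← hb]
    refine mul_le_mul_of_nonneg_left ?_ hb.le
    by_cases hx : dist (P.center x) z < 2 * ρ
    · exact key x y hb hx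
    by_cases hy : dist (P.center y) z < 2 * ρ
    · have := key y x (by rwa [G.b_symm]) hy
      rw [add_comm (u x)]
      refine le_trans (le_of_eq ?_) this
      ring
    · rw [cutoff_eq_zero hρ (not_lt.1 hx), cutoff_eq_zero hρ (not_lt.1 hy)]
      simpa using add_nonneg (hu0 x) (hu0 y)
  have hsum : ∑' x, ENNReal.ofReal (u x) ≤ 50 := by
    have : ∀ x, ENNReal.ofReal (u x) = ENNReal.ofReal (2 / ρ ^ 2) * ENNReal.ofReal (t x ^ 2) :=
      fun x => by
        rw [← ENNReal.ofReal_mul (by positivity)]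
        congr 1
        simp only [hu]
        ring
    simp_rw [this]
    rw [ENNReal.tsum_mul_left]
    calc _ ≤ ENNReal.ofReal (2 / ρ ^ 2) * ENNReal.ofReal ((5 * ρ) ^ 2) := by gcongr
      _ = ENNReal.ofReal 50 := by
        rw [← ENNReal.ofReal_mul (by positivity)]
        congr 1
        field_simp
        norm_num
      _ = 50 := by simp
  calc G.energy (P.cutoff z ρ) ≤ 2⁻¹ * ∑' x, ∑' y, ENNReal.ofReal (G.b x y * (u x + u y)) := by
        exact mul_le_mul_right (ENNReal.tsum_le_tsum fun x => ENNReal.tsum_le_tsum fun y =>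
          ENNReal.ofReal_le_ofReal (key2 x y)) _
    _ ≤ 2⁻¹ * (2 * (ENNReal.ofReal C * ∑' x, ENNReal.ofReal (u x))) := by
        gcongr
        exact WeightedGraph.tsum_tsum_ofReal_b_mul_add_le hC hu0
    _ = ENNReal.ofReal C * ∑' x, ENNReal.ofReal (u x) := by
        rw [← mul_assoc, ENNReal.inv_mul_cancel (by norm_num) (by norm_num), one_mul]
    _ ≤ ENNReal.ofReal C * 50 := by gcongr

end CirclePacking

/-! ### The metric of the centres is resolving -/

namespace CirclePacking

variable {X : Type*} {P : CirclePacking X} {G : WeightedGraph X}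

theorem tsum_tsum_b_mul_sq_radius_lt_top (hgeom : G.BoundedGeometry) (hbdd : P.Bounded) :
    ∑' x, ∑' y, ENNReal.ofReal (G.b x y * (P.radius x ^ 2 + P.radius y ^ 2)) < ∞ := by
  obtain ⟨C, hC⟩ := hgeom
  refine (WeightedGraph.tsum_tsum_ofReal_b_mul_add_le hC (fun x => sq_nonneg _)).trans_lt ?_
  exact ENNReal.mul_lt_top (by norm_num)
    (ENNReal.mul_lt_top ENNReal.ofReal_lt_top (tsum_sq_radius_lt_top hbdd))

theorem b_mul_sq_dist_le (hsub : P.Subordinate G) (x y : X) :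
    G.b x y * dist (P.center x) (P.center y) ^ 2 ≤
      2 * (G.b x y * (P.radius x ^ 2 + P.radius y ^ 2)) := by
  rcases (G.b_nonneg x y).eq_or_lt with hb | hb
  · simp [← hb]
  have h := pow_le_pow_left₀ dist_nonneg (dist_center_le hsub hb) 2
  have h2 : (P.radius x + P.radius y) ^ 2 ≤ 2 * (P.radius x ^ 2 + P.radius y ^ 2) := by
    nlinarith [sq_nonneg (P.radius x - P.radius y)]
  calc _ ≤ G.b x y * (2 * (P.radius x ^ 2 + P.radius y ^ 2)) := by gcongr; exact h.trans h2
    _ = _ := by ring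

theorem inv_two_mul_tsum_le (hsub : P.Subordinate G) (x : X) :
    2⁻¹ * ∑' y, ENNReal.ofReal (G.b x y * dist (P.center x) (P.center y) ^ 2) ≤
      ∑' y, ENNReal.ofReal (G.b x y * (P.radius x ^ 2 + P.radius y ^ 2)) := by
  calc _ ≤ 2⁻¹ * ∑' y, 2 * ENNReal.ofReal (G.b x y * (P.radius x ^ 2 + P.radius y ^ 2)) := by
        refine mul_le_mul_right (ENNReal.tsum_le_tsum fun y => ?_) _
        refine (ENNReal.ofReal_le_ofReal (b_mul_sq_dist_le hsub x y)).trans_eq ?_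
        rw [ENNReal.ofReal_mul (by norm_num)]
        simp
    _ = _ := by
        rw [ENNReal.tsum_mul_left, ← mul_assoc,
          ENNReal.inv_mul_cancel (by norm_num) (by norm_num), one_mul]

/-- Functions that are Lipschitz with respect to the centres have finite energy. -/
theorem finiteEnergy_of_abs_sub_le (hgeom : G.BoundedGeometry) (hbdd : P.Bounded)
    (hsub : P.Subordinate G) {f : X → ℝ}
    (hf : ∀ x y, |f x - f y| ≤ dist (P.center x) (P.center y)) : G.FiniteEnergy f := by
  refine lt_of_le_of_lt ?_ (tsum_tsum_b_mul_sq_radius_lt_top hgeom hbdd)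
  unfold WeightedGraph.energy
  rw [← ENNReal.tsum_mul_left]
  refine ENNReal.tsum_le_tsum fun x => le_trans ?_ (inv_two_mul_tsum_le hsub x)
  refine mul_le_mul_right (ENNReal.tsum_le_tsum fun y => ENNReal.ofReal_le_ofReal ?_) _
  refine mul_le_mul_of_nonneg_left ?_ (G.b_nonneg x y)
  rw [← sq_abs]
  exact pow_le_pow_left₀ (abs_nonneg _) (hf x y) 2

/-- A finite measure with respect to which the Euclidean metric of the centres is intrinsic. -/
def mass (P : CirclePacking X) (G : WeightedGraph X) (x : X) : ℝ :=
  P.radius x ^ 2 + (∑' y, ENNReal.ofReal (G.b x y * (P.radius x ^ 2 + P.radius y ^ 2))).toReal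

/-- The summand `radius ^ 2` forces strict positivity, whatever the edge sum is; both summands have
finite total by the area bound. -/
theorem isFiniteMeas_mass (hgeom : G.BoundedGeometry) (hbdd : P.Bounded) :
    WeightedGraph.IsFiniteMeas (P.mass G) := by
  constructor
  · intro x
    have := P.radius_pos x
    unfold mass
    positivity
  · refine Summable.add ?_
      (ENNReal.summable_toReal (tsum_tsum_b_mul_sq_radius_lt_top hgeom hbdd).ne)
    simpa [ENNReal.toReal_ofReal, sq_nonneg] using
      ENNReal.summable_toReal (tsum_sq_radius_lt_top hbdd).ne

theorem intrinsic_mass (hgeom : G.BoundedGeometry) (hbdd : P.Bounded) (hsub : P.Subordinate G) :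
    G.Intrinsic (P.mass G) fun x y => dist (P.center x) (P.center y) := by
  intro x
  have hx : ∑' y, ENNReal.ofReal (G.b x y * (P.radius x ^ 2 + P.radius y ^ 2)) ≠ ∞ :=
    ENNReal.ne_top_of_tsum_ne_top (tsum_tsum_b_mul_sq_radius_lt_top hgeom hbdd).ne x
  refine (inv_two_mul_tsum_le hsub x).trans ?_
  rw [← ENNReal.ofReal_toReal hx]
  exact ENNReal.ofReal_le_ofReal (le_add_of_nonneg_left (sq_nonneg _))

/-- Points of the plane that are not centres have arbitrarily small capacity. -/
theorem exists_formNorm_lt (hgeom : G.BoundedGeometry) (hsub : P.Subordinate G) {m : X → ℝ}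
    (hm : WeightedGraph.IsFiniteMeas m) {z : EuclideanSpace ℝ (Fin 2)}
    (hz : z ∉ Set.range P.center) {ε : ℝ≥0∞} (hε : 0 < ε) :
    ∃ g : X → ℝ, ∃ ρ > 0, (∀ x, dist (P.center x) z < ρ → 1 ≤ g x) ∧ G.formNorm m g < ε := by
  obtain ⟨C, hC⟩ := hgeom
  have hm0 : ∀ x, 0 ≤ m x := fun x => (hm.1 x).le
  set S : Set (lp (fun _ : (X × X) ⊕ X => ℝ) 2) := {v | ∃ g : X → ℝ,
    (∃ ρ > 0, ∀ x, dist (P.center x) z < ρ → 1 ≤ g x) ∧ ⇑v = G.formVec m g} with hS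
  have hconv : Convex ℝ S := by
    rintro v ⟨f, ⟨ρ, hρ, hf⟩, hv⟩ w ⟨g, ⟨ρ', hρ', hg⟩, hw⟩ a c ha hc hac
    -- Only some neighbourhood of `z` is required, so the smaller of the two discs serves the
    -- combination.
    refine ⟨a • f + c • g, ⟨min ρ ρ', lt_min hρ hρ', fun x hx => ?_⟩, ?_⟩
    · have h1 := hf x (hx.trans_le (min_le_left _ _))
      have h2 := hg x (hx.trans_le (min_le_right _ _))
      simp only [Pi.add_apply, Pi.smul_apply, smul_eq_mul]
      nlinarith
    · rw [WeightedGraph.formVec_add, WeightedGraph.formVec_smul, WeightedGraph.formVec_smul, ← hv,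
        ← hw]
      rfl
  set ρ : ℕ → ℝ := fun n => 1 / ((n : ℝ) + 1) with hρ
  have hρ0 : ∀ n, 0 < ρ n := fun n => Nat.one_div_pos_of_nat
  have hl2 : ∀ n, WeightedGraph.l2NormSq m (P.cutoff z (ρ n)) ≤ ENNReal.ofReal (∑' x, m x) := by
    intro n
    rw [ENNReal.ofReal_tsum_of_nonneg hm0 hm.2]
    refine ENNReal.tsum_le_tsum fun x => ENNReal.ofReal_le_ofReal ?_
    refine mul_le_of_le_one_right (hm0 x) ?_
    exact pow_le_one₀ (P.cutoff_nonneg _ _ _) (P.cutoff_le_one _ _ _)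
  have h0 : (0 : lp (fun _ : (X × X) ⊕ X => ℝ) 2) ∈ closure S := by
    refine WeightedGraph.mem_of_tendsto_pointwise (G := G) (μ := m) hm0 hconv.closure
      isClosed_closure (f := fun n => P.cutoff z (ρ n)) (g := 0)
      (C := ENNReal.ofReal C * 50 + ENNReal.ofReal (∑' x, m x)) ?_ ?_ ?_ ?_ ?_
    · exact ENNReal.add_lt_top.2
        ⟨ENNReal.mul_lt_top ENNReal.ofReal_lt_top (by norm_num), ENNReal.ofReal_lt_top⟩
    · exact fun n => add_le_add (energy_cutoff_le hC hsub z (hρ0 n)) (hl2 n)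
    · exact fun n v hv => subset_closure
        ⟨_, ⟨ρ n, hρ0 n, fun x hx => (cutoff_eq_one (hρ0 n) hx).ge⟩, hv⟩
    · rw [WeightedGraph.formVec_zero]; rfl
    · intro x
      -- As `z` is not a centre, `x` lies outside the supports of the cut-offs from some index on.
      have hd : 0 < dist (P.center x) z := dist_pos.2 fun h => hz ⟨x, h⟩
      have hlim : Tendsto (fun n => 2 * ρ n) atTop (𝓝 (2 * 0)) :=
        tendsto_one_div_add_atTop_nhds_zero_nat.const_mul 2
      rw [mul_zero] at hlim
      refine tendsto_const_nhds.congr' ?_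
      filter_upwards [hlim.eventually (eventually_lt_nhds hd)] with n hn
      exact (cutoff_eq_zero (hρ0 n) hn.le).symm
  obtain ⟨δ, hδ, hδε⟩ : ∃ δ : ℝ, 0 < δ ∧ ENNReal.ofReal (δ ^ 2) ≤ ε := by
    obtain ⟨e, he0, he⟩ := ENNReal.lt_iff_exists_nnreal_btwn.1 hε
    refine ⟨√(e : ℝ), Real.sqrt_pos.2 (by simpa using he0), ?_⟩
    rw [Real.sq_sqrt e.coe_nonneg, ENNReal.ofReal_coe_nnreal]
    exact he.le
  obtain ⟨v, ⟨g, ⟨ρ', hρ', hg⟩, hv⟩, hvδ⟩ := Metric.mem_closure_iff.1 h0 δ hδ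
  refine ⟨g, ρ', hρ', hg, lt_of_lt_of_le ?_ hδε⟩
  rw [← WeightedGraph.ofReal_norm_sq_eq_formNorm hm0 hv]
  rw [dist_zero_left] at hvδ
  refine (ENNReal.ofReal_lt_ofReal_iff (by positivity)).2 ?_
  gcongr

theorem cap_le_formNorm {m g : X → ℝ} (hg : g ∈ G.sobolev m) {U : Set X} (hU : ∀ x ∈ U, 1 ≤ g x) :
    G.cap m U ≤ G.formNorm m g := by
  rw [WeightedGraph.formNorm, add_comm]
  unfold WeightedGraph.cap
  exact iInf₂_le g ⟨hg, hU⟩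

/-- The Euclidean metric of the centres of a bounded circle packing is resolving. -/
theorem isResolvingMetric_centerMetric (hgeom : G.BoundedGeometry) (hbdd : P.Bounded)
    (hsub : P.Subordinate G) : G.IsResolvingMetric P.centerMetric := by
  let _ := P.centerMetric
  have hiso : Isometry P.center := Isometry.of_dist_eq fun _ _ => rfl
  have hm := isFiniteMeas_mass hgeom hbdd
  refine ⟨?_, P.mass G, hm, intrinsic_mass hgeom hbdd hsub, fun w hw => ?_⟩
  · rw [discreteTopology_iff_isOpen_singleton]
    refine fun x => Metric.isOpen_iff.2 fun y hy => ?_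
    obtain rfl : y = x := hy
    refine ⟨P.radius y, P.radius_pos y, fun x hx => ?_⟩
    by_contra hne
    exact absurd (P.radius_le_dist hne) (not_le.2 hx)
  -- The isometry onto the centres extends to the completion and stays injective, so a boundary
  -- point cannot be sent to a centre.
  · set Φ : UniformSpace.Completion X → EuclideanSpace ℝ (Fin 2) :=
      UniformSpace.Completion.extension P.center with hΦ
    have hΦiso : Isometry Φ := hiso.completion_extension
    have hΦc : ∀ x : X, Φ x = P.center x :=
      UniformSpace.Completion.extension_coe hiso.uniformContinuous
    have hz : Φ w ∉ Set.range P.center := by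
      rintro ⟨x, hx⟩
      exact hw ⟨x, hΦiso.injective (by rw [hΦc, hx])⟩
    refine le_antisymm (le_of_forall_gt fun ε hε => ?_) bot_le
    obtain ⟨g, ρ, hρ, hg, hgε⟩ := exists_formNorm_lt hgeom hsub hm hz hε
    refine lt_of_le_of_lt ?_ hgε
    have hO : IsOpen (Φ ⁻¹' Metric.ball (Φ w) ρ) ∧ {w} ⊆ Φ ⁻¹' Metric.ball (Φ w) ρ :=
      ⟨Metric.isOpen_ball.preimage hΦiso.continuous,
        Set.singleton_subset_iff.2 (Metric.mem_ball_self hρ)⟩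
    have hgS : g ∈ G.sobolev (P.mass G) :=
      ⟨lt_of_le_of_lt le_add_self (hgε.trans_le le_top),
        lt_of_le_of_lt le_self_add (hgε.trans_le le_top)⟩
    have hgO : ∀ x ∈ ((↑) : X → UniformSpace.Completion X) ⁻¹' (Φ ⁻¹' Metric.ball (Φ w) ρ),
        1 ≤ g x := fun x hx => hg x (by
      have hx' : dist (Φ x) (Φ w) < ρ := hx
      rwa [hΦc] at hx')
    refine le_trans ?_ (cap_le_formNorm hgS hgO)
    unfold WeightedGraph.capCompletion
    exact iInf₂_le (Φ ⁻¹' Metric.ball (Φ w) ρ) hO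

end CirclePacking

namespace WeightedGraph

variable {X : Type*} {G : WeightedGraph X}

/-! ### Harmonic functions -/

/-- Domination through `|t| ≤ 1 + t²`: the degree and the energy at `x` are both finite. -/
theorem FiniteEnergy.summable_b_mul_sub {h : X → ℝ} (hh : G.FiniteEnergy h) (x : X) :
    Summable fun y => G.b x y * (h x - h y) := by
  have h1 : ∑' x, ∑' y, ENNReal.ofReal (G.b x y * (h x - h y) ^ 2) ≠ ∞ := fun htop => by
    apply hh.ne
    rw [energy, htop, ENNReal.mul_top (by simp)]
  have h2 := ENNReal.summable_toReal (ENNReal.ne_top_of_tsum_ne_top h1 x)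
  have h3 : Summable fun y => G.b x y * (h x - h y) ^ 2 :=
    h2.congr fun y => ENNReal.toReal_ofReal (mul_nonneg (G.b_nonneg x y) (sq_nonneg _))
  refine Summable.of_norm_bounded ((G.b_summable x).add h3) fun y => ?_
  rw [Real.norm_eq_abs, abs_mul, abs_of_nonneg (G.b_nonneg x y)]
  have : |h x - h y| ≤ 1 + (h x - h y) ^ 2 := by
    rw [← sq_abs]
    nlinarith [sq_nonneg (|h x - h y| - 1), abs_nonneg (h x - h y)]
  nlinarith [mul_le_mul_of_nonneg_left this (G.b_nonneg x y)]

/-- At a vertex of degree zero the convention `1 / 0 = 0` turns the mean into `0`, whence the extra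
condition `h0`. -/
theorem superharmonic_of_hasSum_zero {h : X → ℝ}
    (hs : ∀ x, HasSum (fun y => G.b x y * (h x - h y)) 0) (h0 : ∀ x, G.deg x = 0 → h x = 0) :
    G.Superharmonic h := by
  intro x
  have h1 : HasSum (fun y => G.b x y * h y) (G.deg x * h x) := by
    have := ((G.b_summable x).hasSum.mul_right (h x)).sub (hs x)
    rw [sub_zero] at this
    exact this.congr_fun fun y => by ring
  refine ⟨h1.summable.abs, ?_⟩
  rw [h1.tsum_eq]
  by_cases hd : G.deg x = 0
  · rw [hd, h0 x hd]; simp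
  · rw [← mul_assoc, one_div_mul_cancel hd, one_mul]

theorem harmonic_of_hasSum_zero {h : X → ℝ}
    (hs : ∀ x, HasSum (fun y => G.b x y * (h x - h y)) 0) (h0 : ∀ x, G.deg x = 0 → h x = 0) :
    G.Harmonic h := by
  refine ⟨superharmonic_of_hasSum_zero hs h0, superharmonic_of_hasSum_zero (fun x => ?_)
    fun x hx => by simp [h0 x hx]⟩
  have := (hs x).neg
  rw [neg_zero] at this
  exact this.congr_fun fun y => by simp only [Pi.neg_apply]; ring

theorem Connected.deg_pos (hconn : G.Connected) {x y : X} (h : x ≠ y) : 0 < G.deg x := by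
  obtain ⟨p⟩ := hconn.preconnected x y
  cases p with
  | nil => exact absurd rfl h
  | cons hadj _ => exact lt_of_lt_of_le hadj ((G.b_summable x).le_tsum _ fun z _ => G.b_nonneg x z)

/-! ### The form norm with a base point -/

/-- The unit mass at `o`. -/
def unitMass (o : X) : X → ℝ := Set.indicator {o} 1

theorem unitMass_nonneg (o x : X) : 0 ≤ unitMass o x :=
  Set.indicator_nonneg (fun _ _ => zero_le_one) x

@[simp]
theorem unitMass_self (o : X) : unitMass o o = 1 := by simp [unitMass]

theorem unitMass_of_ne {o x : X} (h : x ≠ o) : unitMass o x = 0 := by simp [unitMass, h]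

theorem l2NormSq_unitMass (o : X) (f : X → ℝ) :
    l2NormSq (unitMass o) f = ENNReal.ofReal (f o ^ 2) := by
  rw [l2NormSq, tsum_eq_single o fun x hx => by simp [unitMass_of_ne hx]]
  simp

theorem formNorm_unitMass_lt_top {o : X} {f : X → ℝ} (hf : G.FiniteEnergy f) :
    G.formNorm (unitMass o) f < ∞ := by
  rw [formNorm, l2NormSq_unitMass]
  exact ENNReal.add_lt_top.2 ⟨hf, ENNReal.ofReal_lt_top⟩

theorem energy_unitMass_lt_top (hgeom : G.BoundedGeometry) (x : X) :
    G.FiniteEnergy (unitMass x) := by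
  obtain ⟨C, hC⟩ := hgeom
  have h := tsum_tsum_ofReal_b_mul_add_le hC (unitMass_nonneg x)
  rw [tsum_eq_single (f := fun y => ENNReal.ofReal (unitMass x y)) x
    fun y hy => by simp [unitMass_of_ne hy]] at h
  have h2 : G.energy (unitMass x) ≤
      2⁻¹ * ∑' a, ∑' c, ENNReal.ofReal (G.b a c * (unitMass x a + unitMass x c)) := by
    refine mul_le_mul_right (ENNReal.tsum_le_tsum fun a => ENNReal.tsum_le_tsum fun c =>
      ENNReal.ofReal_le_ofReal (mul_le_mul_of_nonneg_left ?_ (G.b_nonneg a c))) _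
    by_cases ha : a = x <;> by_cases hc : c = x <;> simp [ha, hc, unitMass]
  refine h2.trans_lt (ENNReal.mul_lt_top (by simp) (h.trans_lt ?_))
  exact ENNReal.mul_lt_top (by simp) (ENNReal.mul_lt_top (by simp) (by simp))

variable (G) in
/-- The vectors of the functions that belong to a given space. -/
def formSpace (μ : X → ℝ) (S : Submodule ℝ (X → ℝ)) :
    Submodule ℝ (lp (fun _ : (X × X) ⊕ X => ℝ) 2) where
  carrier := {v | ∃ f ∈ S, ⇑v = G.formVec μ f}
  add_mem' := by
    rintro v w ⟨f, hf, hv⟩ ⟨g, hg, hw⟩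
    exact ⟨f + g, S.add_mem hf hg, by rw [formVec_add, ← hv, ← hw]; rfl⟩
  zero_mem' := ⟨0, S.zero_mem, by rw [formVec_zero]; rfl⟩
  smul_mem' := by
    rintro c v ⟨f, hf, hv⟩
    exact ⟨c • f, S.smul_mem c hf, by rw [formVec_smul, ← hv]; rfl⟩

/-- The finitely supported functions. -/
def finSupport (X : Type*) : Submodule ℝ (X → ℝ) where
  carrier := {f | f.support.Finite}
  add_mem' := fun hf hg => (hf.union hg).subset (Function.support_add _ _)
  zero_mem' := by simp
  smul_mem' := fun c _ hf => hf.subset (Function.support_const_smul_subset c _)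

variable (G) in
/-- The closure of the finitely supported functions in the form norm with base point `o`. -/
def formZero (o : X) : Submodule ℝ (lp (fun _ : (X × X) ⊕ X => ℝ) 2) :=
  (G.formSpace (unitMass o) (finSupport X)).topologicalClosure

variable (G) in
/-- `f` belongs to the form closure of the finitely supported functions. -/
def VanishesAtBoundary (o : X) (f : X → ℝ) : Prop :=
  ∃ v ∈ G.formZero o, ⇑v = G.formVec (unitMass o) f

/-- Telescoping along a path to `o`: each increment, and the value at `o`, is a coordinate of `v` up
to a fixed factor. Hence norm convergence implies pointwise convergence. -/
theorem Connected.exists_abs_apply_le (hconn : G.Connected) (o x : X) :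
    ∃ C : ℝ, ∀ (f : X → ℝ) (v : lp (fun _ : (X × X) ⊕ X => ℝ) 2),
      ⇑v = G.formVec (unitMass o) f → |f x| ≤ C * ‖v‖ := by
  obtain ⟨p⟩ := hconn.preconnected x o
  induction p with
  | nil =>
    rename_i o
    refine ⟨1, fun f v hv => ?_⟩
    have h := lp.norm_apply_le_norm (by norm_num) v (Sum.inr o)
    rw [hv] at h
    simpa [formVec] using h
  | cons hadj _ ih =>
    rename_i x y o _
    obtain ⟨C, hC⟩ := ih
    have hb : 0 < √(G.b x y / 2) := Real.sqrt_pos.2 (half_pos hadj)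
    refine ⟨C + 1 / √(G.b x y / 2), fun f v hv => ?_⟩
    have h := lp.norm_apply_le_norm (by norm_num) v (Sum.inl (x, y))
    rw [hv, Real.norm_eq_abs] at h
    simp only [formVec, Sum.elim_inl, abs_mul, abs_of_pos hb] at h
    have h1 : |f x - f y| ≤ 1 / √(G.b x y / 2) * ‖v‖ := by
      rw [one_div, inv_mul_eq_div, le_div_iff₀ hb, mul_comm]
      exact h
    have h2 := hC f v hv
    have h3 : |f x| ≤ |f x - f y| + |f y| := by
      simpa using abs_add_le (f x - f y) (f y)
    linarith

theorem Connected.tendsto_apply (hconn : G.Connected) {o : X} {f : ℕ → X → ℝ} {g : X → ℝ}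
    {v : ℕ → lp (fun _ : (X × X) ⊕ X => ℝ) 2} {w : lp (fun _ : (X × X) ⊕ X => ℝ) 2}
    (hv : ∀ n, ⇑(v n) = G.formVec (unitMass o) (f n)) (hw : ⇑w = G.formVec (unitMass o) g)
    (h : Tendsto v atTop (𝓝 w)) (x : X) : Tendsto (fun n => f n x) atTop (𝓝 (g x)) := by
  obtain ⟨C, hC⟩ := hconn.exists_abs_apply_le o x
  rw [tendsto_iff_dist_tendsto_zero]
  have h1 := (tendsto_iff_norm_sub_tendsto_zero.1 h).const_mul C
  rw [mul_zero] at h1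
  refine squeeze_zero (fun _ => dist_nonneg) (fun n => ?_) h1
  have := hC (f n - g) (v n - w) (by rw [formVec_sub, ← hv, ← hw]; rfl)
  simpa [Real.dist_eq] using this

/-- A norm limit comes from the pointwise limit of the functions. This lets a projection remainder
be read as a function on `X`. -/
theorem Connected.isClosed_formSpace_top (hconn : G.Connected) (o : X) :
    IsClosed (G.formSpace (unitMass o) ⊤ : Set (lp (fun _ : (X × X) ⊕ X => ℝ) 2)) := by
  refine isClosed_of_closure_subset fun w hw => ?_
  obtain ⟨v, hv, hlim⟩ := mem_closure_iff_seq_limit.1 hw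
  choose f _ hf using hv
  have hcau : ∀ x, CauchySeq fun n => f n x := by
    intro x
    obtain ⟨C, hC⟩ := hconn.exists_abs_apply_le o x
    rw [cauchySeq_iff_tendsto_dist_atTop_0]
    have h1 := (cauchySeq_iff_tendsto_dist_atTop_0.1 hlim.cauchySeq).const_mul C
    rw [mul_zero] at h1
    refine squeeze_zero (fun _ => dist_nonneg) (fun n => ?_) h1
    have := hC (f n.1 - f n.2) (v n.1 - v n.2) (by rw [formVec_sub, ← hf, ← hf]; rfl)
    simpa [Real.dist_eq, dist_eq_norm] using this
  choose g hg using fun x => cauchySeq_tendsto_of_complete (hcau x)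
  refine ⟨g, trivial, funext fun i => ?_⟩
  refine tendsto_nhds_unique (f := fun n => v n i) (l := atTop) ?_ ?_
  · rw [tendsto_iff_norm_sub_tendsto_zero] at hlim ⊢
    exact squeeze_zero (fun _ => norm_nonneg _)
      (fun n => lp.norm_apply_le_norm (by norm_num) (v n - w) i) hlim
  · simp only [hf]
    exact tendsto_formVec hg i

theorem inner_const_one {o : X} {h : X → ℝ} {q e : lp (fun _ : (X × X) ⊕ X => ℝ) 2}
    (hq : ⇑q = G.formVec (unitMass o) h) (he : ⇑e = G.formVec (unitMass o) (fun _ => 1)) :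
    inner ℝ q e = h o := by
  refine (lp.hasSum_inner q e).unique ?_
  have := hasSum_single (f := fun i => inner ℝ (q i) (e i)) (Sum.inr o) ?_
  · simpa [hq, he, formVec] using this
  · rintro (p | x) hx
    · simp [he, formVec]
    · have : x ≠ o := fun h => hx (by rw [h])
      simp [he, formVec, unitMass_of_ne this]

/-- Green's formula against a point mass. The ordered pairs starting at `x` and those ending at `x`
give half of the sum each; `ho` removes the base point term. -/
theorem inner_unitMass {o : X} {h : X → ℝ} (hh : G.FiniteEnergy h) (ho : h o = 0) {x : X}
    {q u : lp (fun _ : (X × X) ⊕ X => ℝ) 2}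
    (hq : ⇑q = G.formVec (unitMass o) h) (hu : ⇑u = G.formVec (unitMass o) (unitMass x)) :
    inner ℝ q u = ∑' y, G.b x y * (h x - h y) := by
  classical
  set A := ∑' y, G.b x y * (h x - h y) with hA
  have hs : HasSum (fun y => G.b x y / 2 * (h x - h y)) (A / 2) :=
    ((hh.summable_b_mul_sub x).hasSum.div_const 2).congr_fun fun y => by ring
  have h1 : HasSum (fun p : X × X => if p.1 = x then G.b x p.2 / 2 * (h x - h p.2) else 0)
      (A / 2) := by
    rw [← (Prod.mk_right_injective x).hasSum_iff]
    · simpa [Function.comp_def] using hs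
    · rintro ⟨a, c⟩ hp
      exact if_neg fun hax : a = x => hp ⟨c, by rw [hax]⟩
  have h2 : HasSum (fun p : X × X => if p.2 = x then G.b x p.1 / 2 * (h x - h p.1) else 0)
      (A / 2) := by
    rw [← (Prod.mk_left_injective x).hasSum_iff]
    · simpa [Function.comp_def] using hs
    · rintro ⟨a, c⟩ hp
      exact if_neg fun hcx : c = x => hp ⟨a, by rw [hcx]⟩
  refine (lp.hasSum_inner q u).unique ?_
  have h3 : HasSum ((fun i => inner ℝ (q i) (u i)) ∘ Sum.inl) A := by
    have h12 := h1.add h2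
    rw [add_halves] at h12
    refine h12.congr_fun ?_
    rintro ⟨a, c⟩
    have hsq : √(G.b a c / 2) * √(G.b a c / 2) = G.b a c / 2 :=
      Real.mul_self_sqrt (by have := G.b_nonneg a c; positivity)
    have : inner ℝ (q (Sum.inl (a, c))) (u (Sum.inl (a, c))) =
        G.b a c / 2 * ((h a - h c) * (unitMass x a - unitMass x c)) := by
      rw [← hsq, hq, hu]
      simp only [formVec, Sum.elim_inl, Real.inner_apply]
      ring
    simp only [Function.comp_apply]
    rw [this]
    by_cases ha : a = x <;> by_cases hc : c = x
    · simp [ha, hc]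
    · simp [ha, hc, unitMass_of_ne hc]
    · simp [ha, hc, unitMass_of_ne ha, G.b_symm a x]
    · simp [ha, hc, unitMass_of_ne ha, unitMass_of_ne hc]
  have h4 : HasSum ((fun i => inner ℝ (q i) (u i)) ∘ Sum.inr) (0 : ℝ) := by
    refine hasSum_zero.congr_fun fun a => ?_
    by_cases ha : a = o
    · simp [hq, formVec, ha, ho]
    · simp [hq, formVec, unitMass_of_ne ha]
  simpa using HasSum.sum h3 h4

/-! ### The space of functions that vanish at the boundary -/

variable {o : X}

theorem VanishesAtBoundary.add {f g : X → ℝ} (hf : G.VanishesAtBoundary o f)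
    (hg : G.VanishesAtBoundary o g) : G.VanishesAtBoundary o (f + g) := by
  obtain ⟨v, hv, hvf⟩ := hf
  obtain ⟨w, hw, hwg⟩ := hg
  exact ⟨v + w, add_mem hv hw, by rw [formVec_add, ← hvf, ← hwg]; rfl⟩

theorem VanishesAtBoundary.smul {f : X → ℝ} (c : ℝ) (hf : G.VanishesAtBoundary o f) :
    G.VanishesAtBoundary o (c • f) := by
  obtain ⟨v, hv, hvf⟩ := hf
  exact ⟨c • v, Submodule.smul_mem _ c hv, by rw [formVec_smul, ← hvf]; rfl⟩

theorem vanishesAtBoundary_unitMass (hgeom : G.BoundedGeometry) (o x : X) :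
    G.VanishesAtBoundary o (unitMass x) := by
  obtain ⟨u, hu⟩ := exists_coe_eq_formVec (unitMass_nonneg o)
    (formNorm_unitMass_lt_top (o := o) (energy_unitMass_lt_top hgeom x))
  refine ⟨u, Submodule.le_topologicalClosure _ ⟨_, ?_, hu⟩, hu⟩
  exact (Set.finite_singleton x).subset Set.support_indicator_subset

/-- The functions that vanish at the boundary form an order ideal. -/
theorem VanishesAtBoundary.of_le_abs (hconn : G.Connected) {f g : X → ℝ}
    (hg : G.VanishesAtBoundary o g) (hf : G.FiniteEnergy f) (hf0 : ∀ x, 0 ≤ f x)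
    (hfg : ∀ x, f x ≤ |g x|) : G.VanishesAtBoundary o f := by
  obtain ⟨w, hw, hwg⟩ := hg
  obtain ⟨v, hv, hlim⟩ := mem_closure_iff_seq_limit.1 hw
  choose k hk hkv using hv
  have hpt := hconn.tendsto_apply hkv hwg hlim
  obtain ⟨M, hM⟩ := hlim.norm.bddAbove_range
  have hM' : ∀ n, G.formNorm (unitMass o) (k n) ≤ ENNReal.ofReal (M ^ 2) := fun n => by
    rw [← ofReal_norm_sq_eq_formNorm (unitMass_nonneg o) (hkv n)]
    exact ENNReal.ofReal_le_ofReal (pow_le_pow_left₀ (norm_nonneg _) (hM ⟨n, rfl⟩) 2)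
  have hE := formNorm_unitMass_lt_top (o := o) hf
  obtain ⟨u, hu⟩ := exists_coe_eq_formVec (unitMass_nonneg o) hE
  refine ⟨u, ?_, hu⟩
  -- The functions `min f |k n|` have finite support, bounded form norm and pointwise limit `min f
  -- |g| = f`, so weak closedness suffices.
  refine mem_of_tendsto_pointwise (unitMass_nonneg o) (G.formZero o).convex
    (Submodule.isClosed_topologicalClosure _) (f := fun n x => min (f x) |k n x|)
    (C := G.formNorm (unitMass o) f + ENNReal.ofReal (M ^ 2))
    (ENNReal.add_lt_top.2 ⟨hE, ENNReal.ofReal_lt_top⟩) (fun n => ?_) (fun n z hz => ?_) hu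
    (fun x => ?_)
  · refine (formNorm_le_add (unitMass_nonneg o) (f := f) (g := k n) (fun x y => ?_)
      (fun x => ?_)).trans (add_le_add le_rfl (hM' n))
    · rw [← sq_abs, ← sq_abs (f x - f y), ← sq_abs (k n x - k n y)]
      have h1 := abs_min_sub_min_le_max (f x) |k n x| (f y) |k n y|
      have h2 := abs_abs_sub_abs_le_abs_sub (k n x) (k n y)
      rcases le_max_iff.1 h1 with h | h
      · exact (pow_le_pow_left₀ (abs_nonneg _) h 2).trans (le_add_of_nonneg_right (sq_nonneg _))
      · exact (pow_le_pow_left₀ (abs_nonneg _) (h.trans h2) 2).trans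
          (le_add_of_nonneg_left (sq_nonneg _))
    · exact (pow_le_pow_left₀ (le_min (hf0 x) (abs_nonneg _)) (min_le_left _ _) 2).trans
        (le_add_of_nonneg_right (sq_nonneg _))
  · refine Submodule.le_topologicalClosure _ ⟨_, (hk n).subset fun x hx => ?_, hz⟩
    rw [Function.mem_support] at hx ⊢
    intro h0
    exact hx (by rw [h0, abs_zero, min_eq_right (hf0 x)])
  · have := (tendsto_const_nhds (x := f x)).min (hpt x).abs
    rwa [min_eq_left (hfg x)] at this

theorem VanishesAtBoundary.mem_energyZero {f : X → ℝ} (hf : G.VanishesAtBoundary o f) :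
    f ∈ G.energyZero o := by
  obtain ⟨v, hv, hvf⟩ := hf
  have hn := ofReal_norm_sq_eq_formNorm (unitMass_nonneg o) hvf
  refine ⟨lt_of_le_of_lt le_self_add (hn.symm.trans_lt ENNReal.ofReal_lt_top), fun ε hε => ?_⟩
  obtain ⟨w, ⟨g, hg, hwg⟩, hvw⟩ := Metric.mem_closure_iff.1 hv ε hε
  refine ⟨g, hg, ?_⟩
  have h1 := ofReal_norm_sq_eq_formNorm (unitMass_nonneg o) (v := v - w) (f := f - g)
    (by rw [formVec_sub, ← hvf, ← hwg]; rfl)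
  rw [formNorm, l2NormSq_unitMass] at h1
  rw [energyNorm, ← h1, ENNReal.ofReal_rpow_of_nonneg (sq_nonneg _) (by norm_num),
    ← Real.sqrt_eq_rpow, Real.sqrt_sq (norm_nonneg _), ENNReal.ofReal_lt_ofReal_iff hε,
    ← dist_eq_norm]
  exact hvw

/-- If a function `≥ 1` vanishes at the boundary then so does the constant function `1`. -/
theorem VanishesAtBoundary.one_of_one_le (hconn : G.Connected) {g : X → ℝ}
    (hg : G.VanishesAtBoundary o g) (h1 : ∀ x, 1 ≤ g x) :
    G.VanishesAtBoundary o fun _ => 1 :=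
  hg.of_le_abs hconn (by simp [FiniteEnergy, energy_const]) (fun _ => zero_le_one)
    fun x => (h1 x).trans (le_abs_self _)

/-- Royden's decomposition when all harmonic functions of finite energy are constant: every
function of finite energy is the sum of a constant and a function that vanishes at the
boundary. -/
theorem exists_vanishesAtBoundary_sub_const (hconn : G.Connected) (hgeom : G.BoundedGeometry)
    (hconst : ∀ h : X → ℝ, G.Harmonic h → G.FiniteEnergy h → ∃ c : ℝ, ∀ x, h x = c)
    (o : X) {f : X → ℝ} (hf : G.FiniteEnergy f) :
    ∃ c : ℝ, G.VanishesAtBoundary o fun x => f x - c := by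
  obtain ⟨v, hv⟩ := exists_coe_eq_formVec (unitMass_nonneg o) (formNorm_unitMass_lt_top (o := o) hf)
  obtain ⟨e, he⟩ := exists_coe_eq_formVec (unitMass_nonneg o) (formNorm_unitMass_lt_top (o := o)
    (G := G) (f := fun _ => 1) (by simp [FiniteEnergy, energy_const]))
  -- In the projection onto `K`, orthogonality of the remainder `h` to `e` means `h o = 0`, and
  -- orthogonality to the point masses means harmonicity. So `h` is constant, hence zero.
  set K := G.formZero o ⊔ Submodule.span ℝ {e} with hK
  have hKc : IsClosed (K : Set (lp (fun _ : (X × X) ⊕ X => ℝ) 2)) :=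
    Submodule.isClosed_sup_finiteDimensional _ _ (Submodule.isClosed_topologicalClosure _)
  have : CompleteSpace K := hKc.completeSpace_coe
  have hKR : K ≤ G.formSpace (unitMass o) ⊤ := by
    refine sup_le (Submodule.topologicalClosure_minimal _ ?_ (hconn.isClosed_formSpace_top o)) ?_
    · rintro w ⟨g, -, hg⟩
      exact ⟨g, trivial, hg⟩
    · rw [Submodule.span_singleton_le_iff_mem]
      exact ⟨_, trivial, he⟩
  obtain ⟨p, hp, q, hq, hpq⟩ := K.exists_add_mem_mem_orthogonal v
  have hqR : q ∈ G.formSpace (unitMass o) ⊤ := by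
    rw [← add_sub_cancel_left p q, ← hpq]
    exact sub_mem ⟨f, trivial, hv⟩ (hKR hp)
  obtain ⟨h, -, hh⟩ := hqR
  have hhE : G.FiniteEnergy h := lt_of_le_of_lt le_self_add
    ((ofReal_norm_sq_eq_formNorm (unitMass_nonneg o) hh).symm.trans_lt ENNReal.ofReal_lt_top)
  have heK : e ∈ K := Submodule.mem_sup_right (Submodule.mem_span_singleton_self e)
  have ho : h o = 0 := by
    rw [← inner_const_one hh he]
    exact (K.mem_orthogonal' q).1 hq e heK
  have hharm : G.Harmonic h := by
    refine harmonic_of_hasSum_zero (fun x => ?_) fun x hx => ?_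
    · obtain ⟨u, hu, hux⟩ := vanishesAtBoundary_unitMass hgeom o x
      rw [← (K.mem_orthogonal' q).1 hq u (Submodule.mem_sup_left hu),
        inner_unitMass hhE ho hh hux]
      exact (hhE.summable_b_mul_sub x).hasSum
    · by_contra hne
      -- By connectedness, a vertex of degree zero can only be `o` itself.
      have hxo : x ≠ o := fun hxo => hne (by rw [hxo, ho])
      exact (hconn.deg_pos hxo).ne' hx
  obtain ⟨c, hc⟩ := hconst h hharm hhE
  have hh0 : h = 0 := funext fun x => by rw [hc x, ← hc o, ho]; rfl
  have hq0 : q = 0 := lp.eq_zero_iff_coeFn_eq_zero.2 (by rw [hh, hh0, formVec_zero])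
  rw [hq0, add_zero] at hpq
  rw [← hpq] at hp
  obtain ⟨k, hk, s, hs, hks⟩ := Submodule.mem_sup.1 hp
  obtain ⟨a, rfl⟩ := Submodule.mem_span_singleton.1 hs
  refine ⟨a, k, hk, ?_⟩
  have hk' : k = v - a • e := by rw [← hks]; abel
  have hfa : (fun x => f x - a) = f - a • fun _ => (1 : ℝ) := by ext x; simp
  rw [hfa, formVec_sub, formVec_smul, ← hv, ← he, hk']
  rfl

end WeightedGraph

/-! ### From small form norm to the constant function -/

namespace WeightedGraph

variable {X : Type*} {G : WeightedGraph X}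

/-- If `1 - g` vanishes at the boundary for functions `g` of arbitrarily small form norm, then the
constant function `1` vanishes at the boundary. -/
theorem vanishesAtBoundary_one_of_small {o : X} {m : X → ℝ} (hm : ∀ x, 0 < m x)
    (h : ∀ ε : ℝ≥0∞, 0 < ε → ∃ g : X → ℝ, G.formNorm m g < ε ∧
      G.VanishesAtBoundary o fun x => 1 - g x) :
    G.VanishesAtBoundary o fun _ => 1 := by
  obtain ⟨e, he⟩ := exists_coe_eq_formVec (unitMass_nonneg o) (formNorm_unitMass_lt_top (o := o)
    (G := G) (f := fun _ => 1) (by simp [FiniteEnergy, energy_const]))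
  have hcl : IsClosed (G.formZero o : Set (lp (fun _ : (X × X) ⊕ X => ℝ) 2)) :=
    Submodule.isClosed_topologicalClosure _
  refine ⟨e, hcl.closure_subset (Metric.mem_closure_iff.2 fun δ hδ => ?_), he⟩
  -- `a` compares the two norms: `g o ^ 2` is at most `1 / m o` times the squared `ℓ²(X, m)` norm of
  -- `g`.
  set a : ℝ := 1 + 1 / m o with ha
  have ha0 : 0 < a := by have := hm o; positivity
  obtain ⟨g, hg, v, hv, hvg⟩ := h (ENNReal.ofReal (δ ^ 2 / a)) (by simp; positivity)
  refine ⟨v, hv, ?_⟩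
  have hn := ofReal_norm_sq_eq_formNorm (G := G) (unitMass_nonneg o) (v := e - v) (f := g) (by
    have : g = (fun _ => 1) - fun x => 1 - g x := by ext x; simp
    rw [this, formVec_sub, ← he, ← hvg]; rfl)
  have hmo : ENNReal.ofReal (g o ^ 2) ≤ ENNReal.ofReal (1 / m o) * l2NormSq m g := by
    calc ENNReal.ofReal (g o ^ 2) = ENNReal.ofReal (1 / m o) * ENNReal.ofReal (m o * g o ^ 2) := by
          rw [← ENNReal.ofReal_mul (one_div_pos.2 (hm o)).le, ← mul_assoc,
            one_div_mul_cancel (hm o).ne', one_mul]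
      _ ≤ _ := by
          gcongr
          exact ENNReal.le_tsum (f := fun x => ENNReal.ofReal (m x * g x ^ 2)) o
  have hle : ENNReal.ofReal (‖e - v‖ ^ 2) ≤ ENNReal.ofReal a * G.formNorm m g := by
    rw [hn, formNorm, l2NormSq_unitMass, ha, ENNReal.ofReal_add zero_le_one
      (one_div_pos.2 (hm o)).le, ENNReal.ofReal_one, add_mul, one_mul, formNorm, mul_add]
    exact add_le_add le_self_add (hmo.trans le_add_self)
  have hlt : ENNReal.ofReal (‖e - v‖ ^ 2) < ENNReal.ofReal (δ ^ 2) := by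
    refine hle.trans_lt ?_
    have : ENNReal.ofReal (δ ^ 2) = ENNReal.ofReal a * ENNReal.ofReal (δ ^ 2 / a) := by
      rw [← ENNReal.ofReal_mul ha0.le, mul_div_cancel₀ _ ha0.ne']
    rw [this]
    exact (ENNReal.mul_lt_mul_iff_right (by simpa using ha0) ENNReal.ofReal_ne_top).2 hg
  rw [dist_eq_norm]
  exact lt_of_pow_lt_pow_left₀ 2 hδ.le ((ENNReal.ofReal_lt_ofReal_iff (by positivity)).1 hlt)

end WeightedGraph

/-! ### Recurrence when all harmonic functions of finite energy are constant -/

namespace CirclePacking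

variable {X : Type*} {P : CirclePacking X} {G : WeightedGraph X}

/-- If all harmonic functions of finite energy are constant, then the distance to some point of the
plane is dominated by a function that vanishes at the boundary. -/
theorem exists_dist_le_vanishesAtBoundary (hconn : G.Connected) (hgeom : G.BoundedGeometry)
    (hbdd : P.Bounded) (hsub : P.Subordinate G)
    (hconst : ∀ h : X → ℝ, G.Harmonic h → G.FiniteEnergy h → ∃ c : ℝ, ∀ x, h x = c) (o : X) :
    ∃ (z : EuclideanSpace ℝ (Fin 2)) (d : X → ℝ), G.VanishesAtBoundary o d ∧
      ∀ x, dist (P.center x) z ≤ d x := by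
  have hcoord : ∀ i : Fin 2, ∃ c : ℝ, G.VanishesAtBoundary o fun x => |P.center x i - c| := by
    intro i
    have hlip : ∀ x y, |P.center x i - P.center y i| ≤ dist (P.center x) (P.center y) := by
      intro x y
      rw [dist_eq_norm]
      exact PiLp.norm_apply_le (P.center x - P.center y) i
    have hE := finiteEnergy_of_abs_sub_le hgeom hbdd hsub hlip
    obtain ⟨c, hc⟩ := WeightedGraph.exists_vanishesAtBoundary_sub_const hconn hgeom hconst o hE
    refine ⟨c, hc.of_le_abs hconn ?_ (fun _ => abs_nonneg _) fun _ => le_rfl⟩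
    refine finiteEnergy_of_abs_sub_le hgeom hbdd hsub fun x y => ?_
    refine (abs_abs_sub_abs_le_abs_sub _ _).trans ?_
    rw [sub_sub_sub_cancel_right]
    exact hlip x y
  choose c hc using hcoord
  -- The Euclidean distance is at most the sum of the two coordinate distances.
  refine ⟨WithLp.toLp 2 c, _, (hc 0).add (hc 1), fun x => ?_⟩
  rw [EuclideanSpace.dist_eq, Fin.sum_univ_two, Real.dist_eq, Real.dist_eq]
  refine Real.sqrt_le_iff.2 ⟨by simp only [Pi.add_apply]; positivity, ?_⟩
  simp only [Pi.add_apply]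
  nlinarith [mul_nonneg (abs_nonneg (P.center x 0 - c 0)) (abs_nonneg (P.center x 1 - c 1))]

/-- If all harmonic functions of finite energy are constant, then the constant function `1` vanishes
at the boundary. -/
theorem vanishesAtBoundary_one (hconn : G.Connected) (hgeom : G.BoundedGeometry)
    (hbdd : P.Bounded) (hsub : P.Subordinate G)
    (hconst : ∀ h : X → ℝ, G.Harmonic h → G.FiniteEnergy h → ∃ c : ℝ, ∀ x, h x = c) (o : X) :
    G.VanishesAtBoundary o fun _ => 1 := by
  obtain ⟨z, d, hd, hdz⟩ := exists_dist_le_vanishesAtBoundary hconn hgeom hbdd hsub hconst o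
  have hd0 : ∀ x, 0 ≤ d x := fun x => dist_nonneg.trans (hdz x)
  by_cases hz : z ∈ Set.range P.center
  · obtain ⟨x₀, rfl⟩ := hz
    have hr := P.radius_pos x₀
    -- Every other centre is at distance at least `radius x₀` from that of `x₀`, so the rescaled `d`
    -- is at least `1` off `x₀`, and the unit mass covers `x₀`.
    refine ((hd.smul (P.radius x₀)⁻¹).add
      (WeightedGraph.vanishesAtBoundary_unitMass hgeom o x₀)).one_of_one_le hconn fun x => ?_
    simp only [Pi.add_apply, Pi.smul_apply, smul_eq_mul]
    have h0 : 0 ≤ (P.radius x₀)⁻¹ * d x := mul_nonneg (inv_nonneg.2 hr.le) (hd0 x)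
    by_cases hx : x = x₀
    · rw [hx] at h0 ⊢
      rw [WeightedGraph.unitMass_self]
      linarith
    · have h1 := (P.radius_le_dist hx).trans (hdz x)
      have h2 : 1 ≤ (P.radius x₀)⁻¹ * d x := by
        rw [inv_mul_eq_div]
        exact (one_le_div hr).2 h1
      have := WeightedGraph.unitMass_nonneg x₀ x
      linarith
  · have hm := isFiniteMeas_mass (P := P) (G := G) hgeom hbdd
    refine WeightedGraph.vanishesAtBoundary_one_of_small hm.1 fun ε hε => ?_
    obtain ⟨g, ρ, hρ, hg, hgε⟩ := exists_formNorm_lt hgeom hsub hm hz hε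
    -- Truncation to `[0, 1]` does not increase the form norm and makes `1 - k` nonnegative. Now `1
    -- - k ≤ ρ⁻¹ d`: the left side vanishes near `z`, and `d ≥ ρ` elsewhere.
    set k : X → ℝ := fun x => max 0 (min 1 (g x)) with hk
    have hk0 : ∀ x, 0 ≤ k x := fun x => le_max_left _ _
    have hk1 : ∀ x, k x ≤ 1 := fun x => max_le zero_le_one (min_le_left _ _)
    have hkg : ∀ x y, |k x - k y| ≤ |g x - g y| := fun x y => by
      refine (abs_max_sub_max_le_max _ _ _ _).trans ?_
      rw [sub_self, abs_zero]
      refine max_le (abs_nonneg _) ((abs_min_sub_min_le_max _ _ _ _).trans ?_)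
      rw [sub_self, abs_zero]
      exact max_le (abs_nonneg _) le_rfl
    have hkg0 : ∀ x, |k x| ≤ |g x| := fun x => by
      rw [abs_of_nonneg (hk0 x)]
      exact max_le (abs_nonneg _) ((min_le_right _ _).trans (le_abs_self _))
    have hkε : G.formNorm (P.mass G) k < ε :=
      (WeightedGraph.formNorm_mono (fun x => (hm.1 x).le) (fun x y => sq_le_sq.2 (hkg x y))
        fun x => sq_le_sq.2 (hkg0 x)).trans_lt hgε
    refine ⟨k, hkε, (hd.smul ρ⁻¹).of_le_abs hconn ?_ (fun x => sub_nonneg.2 (hk1 x)) fun x => ?_⟩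
    · refine (WeightedGraph.energy_mono fun x y => le_of_eq ?_).trans_lt
        (lt_of_le_of_lt le_self_add (hkε.trans_le le_top))
      ring
    · refine le_trans ?_ (le_abs_self _)
      simp only [Pi.smul_apply, smul_eq_mul]
      rcases lt_or_ge (dist (P.center x) z) ρ with hx | hx
      · have : k x = 1 := by
          simp only [hk]
          rw [min_eq_left (hg x hx), max_eq_right zero_le_one]
        rw [this, sub_self]
        exact mul_nonneg (inv_nonneg.2 hρ.le) (hd0 x)
      · have h1 : 1 ≤ ρ⁻¹ * d x := by
          rw [inv_mul_eq_div]
          exact (one_le_div hρ).2 (hx.trans (hdz x))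
        linarith [hk0 x]

end CirclePacking

end

/-! ### The theorem -/

theorem mainTheorem8 {X : Type*} [Countable X] [Nonempty X] (G : WeightedGraph X)
    (hconn : G.Connected) (hgeom : G.BoundedGeometry)
    (P : CirclePacking X) (hbdd : P.Bounded) (hsub : P.Subordinate G) :
    G.IsResolvingMetric P.centerMetric ∧
      G.StronglyResolvable ∧
      (G.Transient →
        ∃ h : X → ℝ, G.Harmonic h ∧ G.FiniteEnergy h ∧ ¬ ∃ c : ℝ, ∀ x, h x = c) := by
  have hres := CirclePacking.isResolvingMetric_centerMetric hgeom hbdd hsub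
  refine ⟨hres, ⟨_, hres⟩, fun htrans => ?_⟩
  by_contra! hconst
  exact htrans fun o =>
    (CirclePacking.vanishesAtBoundary_one hconn hgeom hbdd hsub hconst o).mem_energyZero
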